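/- Let $X$ be a complex Banach space and $T$ a bounded linear operator on $X$. For a bounded operator $S$ on a Banach space $Y$, write $\mathcal N(S)$ and $\mathcal R(S)$ for its kernel and range, $\alpha(S)=\dim\mathcal N(S)$ and $\beta(S)=\operatorname{codim}\mathcal R(S)=\dim Y/\mathcal R(S)$ (both in $\mathbb N\cup\{\infty\}$), and $$p(S)=\inf\{n\in\mathbb N:\mathcal N(S^n)=\mathcal N(S^{n+1})\},\qquad q(S)=\inf\{n\in\mathbb N:\mathcal R(S^n)=\mathcal R(S^{n+1})\},\qquad \inf\emptyset=\infty,$$ for its ascent and descent. $S$ is called semi-regular if $\mathcal R(S)$ is closed and $\mathcal N(S)\cap\mathcal R(S^m)=\mathcal N(S)$ for all $m\in\mathbb N$ (that is, the degree of stable iteration $\operatorname{dis}(S)=\inf\{m\in\mathbb N:\mathcal N(S)\cap\mathcal R(S^m)=\mathcal N(S)\cap\mathcal R(S^r)\ \forall r\ge m\}$ is $0$), and zeroloid if every accumulation point of its spectrum $\sigma(S)$ is $0$. A generalized Kato zeroloid decomposition of $T$, written $(M,N)\in g_zKD(T)$, is a pair of closed $T$-invariant subspaces $M,N$ of $X$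 with $X=M\oplus N$ such that the restriction $T_M$ of $T$ to $M$ is semi-regular and the restriction $T_N$ of $T$ to $N$ is zeroloid; $T$ is called $g_z$-Kato if such a pair exists. If $T$ is $g_z$-Kato, then $\alpha(T_M)$, $\beta(T_M)$, $p(T_M)$ and $q(T_M)$ do not depend on the choice of $(M,N)\in g_zKD(T)$: for all $(M_1,N_1),(M_2,N_2)\in g_zKD(T)$, $$\alpha(T_{M_1})=\alpha(T_{M_2}),\quad \beta(T_{M_1})=\beta(T_{M_2}),\quad p(T_{M_1})=p(T_{M_2}),\quad q(T_{M_1})=q(T_{M_2}).$$ Consequently $\tilde\alpha(T)=\alpha(T_M)$, $\tilde\beta(T)=\beta(T_M)$, $\tilde p(T)=p(T_M)$ and $\tilde q(T)=q(T_M)$, where $(M,N)\in g_zKD(T)$ is arbitrary, are well defined. -/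

import Mathlib

namespace GzKato

noncomputable section

variable {X : Type*} [NormedAddCommGroup X] [NormedSpace ℂ X]

/-- `α(T)`: the dimension of the kernel of `T`, in `ℕ ∪ {∞}`. -/
def alpha (T : X →L[ℂ] X) : ℕ∞ :=
  Cardinal.toENat (Module.rank ℂ (LinearMap.ker (T : X →ₗ[ℂ] X)))

/-- `β(T)`: the (algebraic) codimension of the range of `T`, in `ℕ ∪ {∞}`. -/
def beta (T : X →L[ℂ] X) : ℕ∞ :=
  Cardinal.toENat (Module.rank ℂ (X ⧸ LinearMap.range (T : X →ₗ[ℂ] X)))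

/-- The kernel of `T ^ n`. -/
def kerPow (T : X →L[ℂ] X) (n : ℕ) : Submodule ℂ X :=
  LinearMap.ker ((T ^ n : X →L[ℂ] X) : X →ₗ[ℂ] X)

/-- The range of `T ^ n`. -/
def rangePow (T : X →L[ℂ] X) (n : ℕ) : Submodule ℂ X :=
  LinearMap.range ((T ^ n : X →L[ℂ] X) : X →ₗ[ℂ] X)

/-- The infimum of a set of natural numbers in `ℕ ∪ {∞}`; the infimum of `∅` is `∞`. -/
def natInf (S : Set ℕ) : ℕ∞ := ⨅ n ∈ S, (n : ℕ∞)

/-- The ascent `p(T)`. -/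
def ascent (T : X →L[ℂ] X) : ℕ∞ :=
  natInf {n : ℕ | kerPow T n = kerPow T (n + 1)}

/-- The descent `q(T)`. -/
def descent (T : X →L[ℂ] X) : ℕ∞ :=
  natInf {n : ℕ | rangePow T n = rangePow T (n + 1)}

/-- The degree of stable iteration `dis(T)`: the least `m` such that
`N(T) ∩ R(T ^ m) = N(T) ∩ R(T ^ r)` for all `r ≥ m`. Here `N(T) ∩ R(T ^ m)` is the kernel of the
restriction of `T` to `R(T ^ m)`. -/
def dis (T : X →L[ℂ] X) : ℕ∞ :=
  natInf {m : ℕ | ∀ r : ℕ, m ≤ r → kerPow T 1 ⊓ rangePow T m = kerPow T 1 ⊓ rangePow T r}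

/-- `T` is semi-regular: its range is closed and `dis(T) = 0`. -/
def IsSemiRegular (T : X →L[ℂ] X) : Prop :=
  IsClosed (Set.range T) ∧ dis T = 0

/-- `T` is zeroloid: every accumulation point of its spectrum is `0`. -/
def IsZeroloid (T : X →L[ℂ] X) : Prop :=
  {z : ℂ | AccPt z (Filter.principal (spectrum ℂ T))} ⊆ {0}

/-- The restriction `T_M` of `T` to a `T`-invariant subspace `M`, as a bounded operator on `M`. -/
def restr (T : X →L[ℂ] X) (M : Submodule ℂ X) (h : ∀ x ∈ M, T x ∈ M) : M →L[ℂ] M :=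
  T.restrict h

/-- `(M, N) ∈ Red(T)`: `M` and `N` are closed `T`-invariant subspaces and `X = M ⊕ N`. -/
structure IsRed (T : X →L[ℂ] X) (M N : Submodule ℂ X) : Prop where
  closed_left : IsClosed (M : Set X)
  closed_right : IsClosed (N : Set X)
  inv_left : ∀ x ∈ M, T x ∈ M
  inv_right : ∀ x ∈ N, T x ∈ N
  isCompl : IsCompl M N

/-- `(M, N) ∈ g_z KD(T)`: `(M, N) ∈ Red(T)`, `T_M` is semi-regular and `T_N` is zeroloid. -/
structure IsGzKD (T : X →L[ℂ] X) (M N : Submodule ℂ X) : Prop extends IsRed T M N where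
  semiRegular : IsSemiRegular (restr T M inv_left)
  zeroloid : IsZeroloid (restr T N inv_right)

/-- `T` is a `g_z`-Kato operator. -/
def IsGzKato (T : X →L[ℂ] X) : Prop :=
  ∃ M N : Submodule ℂ X, IsGzKD T M N

/-- The restriction of a `g_z`-Kato operator `T` to the first summand of some (chosen)
decomposition in `g_z KD(T)`. -/
def chosenPart (T : X →L[ℂ] X) (hT : IsGzKato T) : hT.choose →L[ℂ] hT.choose :=
  restr T hT.choose hT.choose_spec.choose_spec.inv_left

/-- `α̃(T)`, computed from a chosen decomposition. -/
def alphaTilde (T : X →L[ℂ] X) (hT : IsGzKato T) : ℕ∞ := alpha (chosenPart T hT)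

/-- `β̃(T)`, computed from a chosen decomposition. -/
def betaTilde (T : X →L[ℂ] X) (hT : IsGzKato T) : ℕ∞ := beta (chosenPart T hT)

/-- `p̃(T)`, computed from a chosen decomposition. -/
def ascentTilde (T : X →L[ℂ] X) (hT : IsGzKato T) : ℕ∞ := ascent (chosenPart T hT)

/-- `q̃(T)`, computed from a chosen decomposition. -/
def descentTilde (T : X →L[ℂ] X) (hT : IsGzKato T) : ℕ∞ := descent (chosenPart T hT)

end

end GzKato

namespace GzKato

open Filter Topology

/-! ### Kernel and cokernel dimensions under complements, restrictions and quotients. -/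

section LinearAlgebra

variable {E : Type*} [AddCommGroup E] [Module ℂ E]

/-! If `z` is outside the spectrum of `T_N`, then `T_N - z` is bijective, so `T_M - z` and `T - z`
have the same `α` and `β`; these do not involve `(M, N)`. For semi-regular `A`, `α(A - z)` and `β(A
- z)` tend in `ℕ∞` to `α(A)` and `β(A)` as `z → 0`, `z ≠ 0` (`tendsto_alpha`, `tendsto_beta`).
Points outside both zeroloid spectra accumulate at `0`, so uniqueness of limits gives `α` and `β`.

The limits come from the hyperrange `R = ⋂ R(A^n)`, which is closed: `A` is onto on `R`, which
carries all of `α`, and injective with closed range on `Y ⧸ R`, which carries all of `β`. Both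
properties are stable under small perturbations.

For semi-regular `A` the ascent and descent are `0` or `∞`, and they vanish exactly when `α`,
respectively `β`, does. -/

theorem exists_finiteDimensional_le_of_le_rank {n : ℕ} (C : Submodule ℂ E)
    (h : (n : Cardinal) ≤ Module.rank ℂ C) :
    ∃ F ≤ C, FiniteDimensional ℂ F ∧ Module.rank ℂ F = n := by
  obtain ⟨v, hv⟩ := Module.le_rank_iff.1 h
  have hw : LinearIndependent ℂ (C.subtype ∘ v) := hv.map' _ C.ker_subtype
  refine ⟨Submodule.span ℂ (Set.range (C.subtype ∘ v)), ?_,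
    FiniteDimensional.span_of_finite ℂ (Set.finite_range _), ?_⟩
  · rw [Submodule.span_le]
    rintro _ ⟨i, rfl⟩
    exact (v i).2
  · simpa using rank_eq_card_basis (Module.Basis.span hw)

/-- Every vector can be moved into the kernel by subtracting an element of `Z`, so the kernel maps
onto `E ⧸ Z ≃ F`. -/
theorem rank_le_rank_ker_of_surjective_domRestrict {F Z : Submodule ℂ E} (hFZ : IsCompl F Z)
    (f : E →ₗ[ℂ] E) (hf : Function.Surjective (f.domRestrict Z)) :
    Module.rank ℂ F ≤ Module.rank ℂ (LinearMap.ker f) := by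
  rw [← (Submodule.quotientEquivOfIsCompl Z F hFZ.symm).rank_eq]
  refine LinearMap.rank_le_of_surjective (Z.mkQ ∘ₗ (LinearMap.ker f).subtype) fun y => ?_
  obtain ⟨x, rfl⟩ := Z.mkQ_surjective y
  obtain ⟨z, hz⟩ := hf (f x)
  refine ⟨⟨x - z, ?_⟩, ?_⟩
  · rw [LinearMap.mem_ker, map_sub, sub_eq_zero]
    exact hz.symm
  · simp

theorem rank_ker_le_rank_of_injective_domRestrict {F Z : Submodule ℂ E} (hFZ : IsCompl F Z)
    (f : E →ₗ[ℂ] E) (hf : Function.Injective (f.domRestrict Z)) :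
    Module.rank ℂ (LinearMap.ker f) ≤ Module.rank ℂ F := by
  rw [← (Submodule.quotientEquivOfIsCompl Z F hFZ.symm).rank_eq]
  refine LinearMap.rank_le_of_injective (Z.mkQ ∘ₗ (LinearMap.ker f).subtype) ?_
  rw [← LinearMap.ker_eq_bot, LinearMap.ker_eq_bot']
  rintro ⟨x, hx⟩ hxZ
  have hxZ' : x ∈ Z := by simpa using hxZ
  have : (⟨x, hxZ'⟩ : Z) = 0 := hf (by simpa using hx)
  simpa using this

theorem rank_le_rank_quotient_of_disjoint {R G : Submodule ℂ E} (h : Disjoint R G) :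
    Module.rank ℂ G ≤ Module.rank ℂ (E ⧸ R) := by
  refine LinearMap.rank_le_of_injective (R.mkQ ∘ₗ G.subtype) ?_
  rw [← LinearMap.ker_eq_bot, LinearMap.ker_eq_bot']
  rintro ⟨x, hx⟩ hxR
  have : x = 0 := Submodule.disjoint_def.1 h x (by simpa using hxR) hx
  simpa using this

theorem rank_quotient_le_rank_of_codisjoint {R G : Submodule ℂ E} (h : Codisjoint R G) :
    Module.rank ℂ (E ⧸ R) ≤ Module.rank ℂ G := by
  refine LinearMap.rank_le_of_surjective (R.mkQ ∘ₗ G.subtype) fun y => ?_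
  obtain ⟨x, rfl⟩ := R.mkQ_surjective y
  obtain ⟨r, hr, g, hg, rfl⟩ := Submodule.mem_sup.1 (h.eq_top ▸ Submodule.mem_top : x ∈ R ⊔ G)
  exact ⟨⟨g, hg⟩, by simpa using hr⟩

theorem rank_ker_restrict {f : E →ₗ[ℂ] E} {R : Submodule ℂ E} (hR : ∀ x ∈ R, f x ∈ R)
    (hf : LinearMap.ker f ≤ R) :
    Module.rank ℂ (LinearMap.ker (f.restrict hR)) = Module.rank ℂ (LinearMap.ker f) := by
  refine (LinearEquiv.ofBijective
    ((R.subtype ∘ₗ (LinearMap.ker (f.restrict hR)).subtype).codRestrict (LinearMap.ker f)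
      fun x => congrArg Subtype.val (LinearMap.mem_ker.1 x.2))
    ⟨fun x y hxy => ?_, fun x => ?_⟩).rank_eq
  · have h : ((x : R) : E) = (y : R) := congrArg (LinearMap.ker f).subtype hxy
    exact Subtype.ext (Subtype.ext h)
  · exact ⟨⟨⟨x, hf x.2⟩, by simp [Subtype.ext_iff]⟩, rfl⟩

theorem rank_quotient_range_mapQ {f : E →ₗ[ℂ] E} {R : Submodule ℂ E} (hR : R ≤ R.comap f)
    (hf : R ≤ LinearMap.range f) :
    Module.rank ℂ ((E ⧸ R) ⧸ LinearMap.range (R.mapQ R f hR)) =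
      Module.rank ℂ (E ⧸ LinearMap.range f) := by
  have : LinearMap.range (R.mapQ R f hR) = (LinearMap.range f).map R.mkQ := by
    rw [Submodule.range_mapQ]
  rw [this]
  exact (Submodule.quotientQuotientEquivQuotient R _ hf).rank_eq

variable {f : E →ₗ[ℂ] E} {M N : Submodule ℂ E}

theorem ker_le_of_isCompl_of_injective_restrict (hM : ∀ x ∈ M, f x ∈ M)
    (hN : ∀ x ∈ N, f x ∈ N) (hMN : IsCompl M N) (hf : Function.Injective (f.restrict hN)) :
    LinearMap.ker f ≤ M := by
  intro x hx
  obtain ⟨m, hm, n, hn, rfl⟩ := Submodule.mem_sup.1 (hMN.sup_eq_top ▸ Submodule.mem_top : x ∈ M ⊔ N)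
  rw [LinearMap.mem_ker, map_add] at hx
  have h0 : f n = 0 := Submodule.disjoint_def.1 hMN.disjoint _
    (by rw [eq_neg_of_add_eq_zero_right hx]; exact M.neg_mem (hM m hm)) (hN n hn)
  have : (⟨n, hn⟩ : N) = 0 := hf (by simpa [Subtype.ext_iff] using h0)
  have hn0 : n = 0 := by simpa using this
  simpa [hn0] using hm

theorem rank_quotient_range_restrict (hM : ∀ x ∈ M, f x ∈ M) (hN : ∀ x ∈ N, f x ∈ N)
    (hMN : IsCompl M N) (hf : Function.Surjective (f.restrict hN)) :
    Module.rank ℂ (M ⧸ LinearMap.range (f.restrict hM)) =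
      Module.rank ℂ (E ⧸ LinearMap.range f) := by
  set φ : M →ₗ[ℂ] E ⧸ LinearMap.range f := (LinearMap.range f).mkQ ∘ₗ M.subtype
  have hφ : Function.Surjective φ := by
    intro y
    obtain ⟨x, rfl⟩ := Submodule.mkQ_surjective _ y
    obtain ⟨m, hm, n, hn, rfl⟩ :=
      Submodule.mem_sup.1 (hMN.sup_eq_top ▸ Submodule.mem_top : x ∈ M ⊔ N)
    obtain ⟨n', hn'⟩ := hf ⟨n, hn⟩
    refine ⟨⟨m, hm⟩, ?_⟩
    have : f n' = n := by simpa using congrArg Subtype.val hn'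
    have hmem : (Submodule.Quotient.mk n : E ⧸ LinearMap.range f) = 0 :=
      (Submodule.Quotient.mk_eq_zero _).2 ⟨n', this⟩
    simp [φ, hmem]
  have hker : LinearMap.ker φ = LinearMap.range (f.restrict hM) := by
    ext ⟨m, hm⟩
    simp only [φ, LinearMap.mem_ker, LinearMap.comp_apply, Submodule.subtype_apply,
      Submodule.mkQ_apply, Submodule.Quotient.mk_eq_zero, LinearMap.mem_range]
    constructor
    · rintro ⟨x, hx⟩
      obtain ⟨m', hm', n, hn, rfl⟩ :=
        Submodule.mem_sup.1 (hMN.sup_eq_top ▸ Submodule.mem_top : x ∈ M ⊔ N)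
      rw [map_add] at hx
      have h0 : f n = 0 := Submodule.disjoint_def.1 hMN.disjoint _
        (by rw [← eq_sub_iff_add_eq'] at hx; rw [hx]; exact M.sub_mem hm (hM m' hm')) (hN n hn)
      exact ⟨⟨m', hm'⟩, Subtype.ext (by simpa [h0] using hx)⟩
    · rintro ⟨x, hx⟩
      exact ⟨x, congrArg Subtype.val hx⟩
  rw [← hker]
  exact (φ.quotKerEquivOfSurjective hφ).rank_eq

end LinearAlgebra

/-! ### Stability of surjectivity and of bounded-below injectivity. -/

section Openness

variable {E F : Type*} [NormedAddCommGroup E] [NormedSpace ℂ E] [CompleteSpace E]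
  [NormedAddCommGroup F] [NormedSpace ℂ F] [CompleteSpace F]

theorem eventually_surjective {f : E →L[ℂ] F} (hf : Function.Surjective f) :
    ∀ᶠ g : E →L[ℂ] F in 𝓝 f, Function.Surjective g := by
  have hr : f.range = ⊤ := LinearMap.range_eq_top.2 hf
  obtain ⟨r, hr0⟩ := f.exists_nonlinearRightInverse_of_surjective hr
  have hpos : (0 : ℝ) < (r.nnnorm : ℝ)⁻¹ := inv_pos.2 (by exact_mod_cast hr0)
  filter_upwards [Metric.ball_mem_nhds f hpos] with g hg y
  rw [mem_ball_iff_norm] at hg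
  have happ : ApproximatesLinearOn g f Set.univ ‖g - f‖₊ := by
    intro x _ y _
    simpa [map_sub, sub_sub_sub_comm] using (g - f).le_opNorm (x - y)
  have hd : 0 < (r.nnnorm : ℝ)⁻¹ - ‖g - f‖₊ := by simpa using hg
  -- The image under `g` of the ball of radius `ε` covers the ball of radius `(‖r‖⁻¹ - ‖g - f‖) ε`;
  -- this `ε` makes it just reach `y`.
  have hε : 0 ≤ ‖y‖ / ((r.nnnorm : ℝ)⁻¹ - ‖g - f‖₊) := by positivity
  obtain ⟨x, -, hx⟩ := happ.surjOn_closedBall_of_nonlinearRightInverse r hε (b := 0)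
    (Set.subset_univ _) (Metric.mem_closedBall.2 (by
      rw [mul_div_assoc', mul_div_cancel_left₀ _ hd.ne', map_zero, dist_zero_right]))
  exact ⟨x, hx⟩

theorem eventually_injective {f : E →L[ℂ] F} (hf : Function.Injective f)
    (hcl : IsClosed (Set.range f)) : ∀ᶠ g : E →L[ℂ] F in 𝓝 f, Function.Injective g := by
  obtain ⟨K, hK⟩ := f.antilipschitz_of_injective_of_isClosed_range hf hcl
  -- `K` may be `0`; `K + 1` is a nonzero antilipschitz constant.
  have hpos : (0 : ℝ) < ((K + 1 : NNReal) : ℝ)⁻¹ := by positivity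
  have hK' : AntilipschitzWith (K + 1) f := fun x y =>
    (hK x y).trans (by gcongr; simp)
  filter_upwards [Metric.ball_mem_nhds f hpos] with g hg
  rw [mem_ball_iff_norm] at hg
  exact (hK'.add_sub_lipschitzWith (g - f).lipschitz (by exact_mod_cast hg)).injective

end Openness

/-! ### Limits of `α` for surjective operators and of `β` for bounded-below ones. -/

section Perturbation

variable {Y : Type*} [NormedAddCommGroup Y] [NormedSpace ℂ Y]

theorem tendsto_toENat_of_eventually {ι : Type*} {l : Filter ι} {c : Cardinal} {g : ι → Cardinal}
    (hlow : ∀ n : ℕ, (n : Cardinal) ≤ c → ∀ᶠ i in l, (n : Cardinal) ≤ g i)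
    (hup : c < Cardinal.aleph0 → ∀ᶠ i in l, g i ≤ c) :
    Tendsto (fun i => Cardinal.toENat (g i)) l (𝓝 (Cardinal.toENat c)) := by
  rcases lt_or_ge c Cardinal.aleph0 with hc | hc
  · obtain ⟨n, rfl⟩ := Cardinal.lt_aleph0.1 hc
    refine tendsto_const_nhds.congr' ?_
    filter_upwards [hlow n le_rfl, hup hc] with i h₁ h₂
    rw [le_antisymm h₁ h₂]
  · rw [Cardinal.toENat_eq_top.2 hc, ENat.tendsto_nhds_top_iff_natCast_lt]
    intro n
    filter_upwards [hlow (n + 1) ((Cardinal.natCast_le_aleph0).trans hc)] with i hi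
    rw [Cardinal.natCast_lt_toENat]
    exact lt_of_lt_of_le (by exact_mod_cast n.lt_succ_self) hi

theorem continuous_sub_smul_one (S : Y →L[ℂ] Y) : Continuous fun z : ℂ => S - z • 1 := by
  fun_prop

theorem tendsto_sub_smul_one (S : Y →L[ℂ] Y) :
    Tendsto (fun z : ℂ => S - z • 1) (𝓝 0) (𝓝 S) := by
  simpa using (continuous_sub_smul_one S).tendsto 0

variable [CompleteSpace Y]

/-- On a closed complement of a finite-dimensional `F ≤ ker S`, `S` is still onto, and so is `S - z`
for small `z`; this bounds `α(S - z)` below by `dim F`. If `F` is the whole kernel, injectivity on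
the complement persists too and gives the upper bound. -/
theorem tendsto_alpha_of_surjective {S : Y →L[ℂ] Y} (hS : Function.Surjective S) :
    Tendsto (fun z : ℂ => alpha (S - z • 1)) (𝓝 0) (𝓝 (alpha S)) := by
  have key : ∀ F ≤ LinearMap.ker (S : Y →ₗ[ℂ] Y), FiniteDimensional ℂ F →
      ∃ Z : Submodule ℂ Y, IsClosed (Z : Set Y) ∧ IsCompl F Z ∧
        Function.Surjective (S ∘L Z.subtypeL) ∧
        Tendsto (fun z : ℂ => (S - z • 1) ∘L Z.subtypeL) (𝓝 0) (𝓝 (S ∘L Z.subtypeL)) := by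
    intro F hF _
    obtain ⟨Z, hZ, hFZ⟩ :=
      (Submodule.ClosedComplemented.of_finiteDimensional F).exists_isClosed_isCompl
    refine ⟨Z, hZ, hFZ, fun y => ?_, ?_⟩
    · obtain ⟨x, rfl⟩ := hS y
      obtain ⟨u, hu, v, hv, rfl⟩ :=
        Submodule.mem_sup.1 (hFZ.sup_eq_top ▸ Submodule.mem_top : x ∈ F ⊔ Z)
      have hu0 : S u = 0 := hF hu
      exact ⟨⟨v, hv⟩, by simp [hu0]⟩
    · have : Continuous fun A : Y →L[ℂ] Y => A ∘L Z.subtypeL := by fun_prop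
      exact (this.tendsto S).comp (tendsto_sub_smul_one S)
  refine tendsto_toENat_of_eventually (fun n hn => ?_) fun hfin => ?_
  · obtain ⟨F, hF, hfd, hFn⟩ := exists_finiteDimensional_le_of_le_rank _ hn
    obtain ⟨Z, hZ, hFZ, hsurj, ht⟩ := key F hF hfd
    have := hZ.completeSpace_coe
    filter_upwards [ht.eventually (eventually_surjective hsurj)] with z hz
    rw [← hFn]
    exact rank_le_rank_ker_of_surjective_domRestrict hFZ _ hz
  · obtain ⟨Z, hZ, hFZ, hsurj, ht⟩ := key _ le_rfl (Module.rank_lt_aleph0_iff.1 hfin)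
    have := hZ.completeSpace_coe
    have hinj : Function.Injective (S ∘L Z.subtypeL) := by
      rw [injective_iff_map_eq_zero]
      rintro ⟨x, hx⟩ h
      have : x = 0 := Submodule.disjoint_def.1 hFZ.disjoint x (by simpa using h) hx
      simpa using this
    filter_upwards [ht.eventually (eventually_injective hinj
      (by rw [hsurj.range_eq]; exact isClosed_univ))] with z hz
    exact rank_ker_le_rank_of_injective_domRestrict hFZ _ hz

/-- Dually, test the range with `(y, g) ↦ V y + g` for finite-dimensional `G`: injectivity with
closed range persists and gives lower bounds, surjectivity gives the upper bound when `β` is finite.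
-/
theorem tendsto_beta_of_injective {V : Y →L[ℂ] Y} (hV : Function.Injective V)
    (hcl : IsClosed (Set.range V)) :
    Tendsto (fun z : ℂ => beta (V - z • 1)) (𝓝 0) (𝓝 (beta V)) := by
  have ht : ∀ G : Submodule ℂ Y, Tendsto (fun z : ℂ => (V - z • 1).coprod G.subtypeL) (𝓝 0)
      (𝓝 (V.coprod G.subtypeL)) := by
    intro G
    have : Continuous fun A : Y →L[ℂ] Y => A.coprod G.subtypeL := by
      have h : (fun A : Y →L[ℂ] Y => A.coprod G.subtypeL) = fun A : Y →L[ℂ] Y =>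
          A ∘L ContinuousLinearMap.fst ℂ Y G + G.subtypeL ∘L ContinuousLinearMap.snd ℂ Y G := by
        ext <;> simp
      rw [h]
      fun_prop
    exact (this.tendsto V).comp (tendsto_sub_smul_one V)
  obtain ⟨C, hC⟩ := Submodule.exists_isCompl (LinearMap.range (V : Y →ₗ[ℂ] Y))
  have hrank := (Submodule.quotientEquivOfIsCompl _ C hC).rank_eq
  refine tendsto_toENat_of_eventually (fun n hn => ?_) fun hfin => ?_
  · rw [hrank] at hn
    obtain ⟨G, hG, hfd, hGn⟩ := exists_finiteDimensional_le_of_le_rank _ hn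
    have hdis := hC.disjoint.mono_right hG
    have hinj : Function.Injective (V.coprod G.subtypeL) := by
      rw [injective_iff_map_eq_zero]
      rintro ⟨y, g⟩ h
      have h' : V y + g = 0 := by simpa using h
      have hg : (g : Y) = 0 := Submodule.disjoint_def.1 hdis _
        ⟨-y, by simpa using (eq_neg_of_add_eq_zero_right h').symm⟩ g.2
      have hy : V y = V 0 := by simpa [hg] using h'
      ext
      · simpa using hV hy
      · simpa using hg
    have hcl' : IsClosed (Set.range (V.coprod G.subtypeL)) := by
      have : Set.range (V.coprod G.subtypeL) =
          ((LinearMap.range (V : Y →ₗ[ℂ] Y) ⊔ G : Submodule ℂ Y) : Set Y) := by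
        ext x
        simp [Submodule.mem_sup]
      rw [this]
      exact Submodule.isClosed_sup_finiteDimensional _ _ hcl
    have := FiniteDimensional.complete ℂ G
    filter_upwards [(ht G).eventually (eventually_injective hinj hcl')] with z hz
    rw [← hGn]
    refine rank_le_rank_quotient_of_disjoint (Submodule.disjoint_def.2 ?_)
    rintro _ ⟨y, rfl⟩ hy
    have := @hz (-y, ⟨_, hy⟩) 0 (by simp)
    simpa using congrArg (fun p => (p.2 : Y)) this
  · rw [hrank] at hfin ⊢
    have := Module.rank_lt_aleph0_iff.1 hfin
    have := FiniteDimensional.complete ℂ C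
    have hsurj : Function.Surjective (V.coprod C.subtypeL) := by
      intro y
      obtain ⟨_, ⟨x, rfl⟩, c, hc, rfl⟩ :=
        Submodule.mem_sup.1 (hC.sup_eq_top ▸ Submodule.mem_top : y ∈ _ ⊔ C)
      exact ⟨(x, ⟨c, hc⟩), by simp⟩
    filter_upwards [(ht C).eventually (eventually_surjective hsurj)] with z hz
    refine rank_quotient_le_rank_of_codisjoint (codisjoint_iff.2 (eq_top_iff.2 fun y _ => ?_))
    obtain ⟨⟨x, c⟩, rfl⟩ := hz y
    exact Submodule.add_mem_sup ⟨x, rfl⟩ c.2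

end Perturbation

/-! ### Semi-regular operators: ascent, descent and hyperrange. -/

section SemiRegular

variable {Y : Type*} [NormedAddCommGroup Y] [NormedSpace ℂ Y] {A : Y →L[ℂ] Y}

theorem mem_rangePow {n : ℕ} {y : Y} : y ∈ rangePow A n ↔ ∃ x, (A ^ n) x = y :=
  Iff.rfl

theorem mem_kerPow {n : ℕ} {y : Y} : y ∈ kerPow A n ↔ (A ^ n) y = 0 :=
  Iff.rfl

theorem pow_succ_apply (n : ℕ) (x : Y) : (A ^ (n + 1)) x = (A ^ n) (A x) := by
  rw [pow_succ]
  rfl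

theorem pow_succ_apply' (n : ℕ) (x : Y) : (A ^ (n + 1)) x = A ((A ^ n) x) := by
  rw [pow_succ']
  rfl

theorem natInf_eq_zero_iff {S : Set ℕ} : natInf S = 0 ↔ 0 ∈ S := by
  constructor
  · intro h
    by_contra h0
    have : (1 : ℕ∞) ≤ natInf S := le_iInf₂ fun n hn => by
      exact_mod_cast Nat.one_le_iff_ne_zero.2 fun hn0 => h0 (hn0 ▸ hn)
    simp [h] at this
  · intro h
    exact le_antisymm (iInf₂_le_of_le 0 h (by simp)) zero_le

theorem natInf_eq_of_mem_imp_zero_mem {S S' : Set ℕ} (hS : ∀ n ∈ S, 0 ∈ S)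
    (hS' : ∀ n ∈ S', 0 ∈ S') (h : 0 ∈ S ↔ 0 ∈ S') : natInf S = natInf S' := by
  by_cases h0 : 0 ∈ S
  · rw [natInf_eq_zero_iff.2 h0, natInf_eq_zero_iff.2 (h.1 h0)]
  · have hS0 : S = ∅ := Set.eq_empty_iff_forall_notMem.2 fun n hn => h0 (hS n hn)
    have hS0' : S' = ∅ := Set.eq_empty_iff_forall_notMem.2 fun n hn => h0 (h.2 (hS' n hn))
    rw [hS0, hS0']

theorem IsSemiRegular.ker_le_rangePow (hA : IsSemiRegular A) (n : ℕ) {x : Y} (hx : A x = 0) :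
    x ∈ rangePow A n := by
  have h := natInf_eq_zero_iff.1 hA.2 n n.zero_le
  have hx' : x ∈ kerPow A 1 ⊓ rangePow A 0 := ⟨by simpa [mem_kerPow] using hx, x, by simp⟩
  rw [h] at hx'
  exact hx'.2

/-- If `A^(n+1) x = 0`, then `A^n x` lies in `ker A`, so it equals `A^(n+1) y` for some `y`; thus `x
- A y` is killed by `A^n` and induction applies. -/
theorem IsSemiRegular.kerPow_le_range (hA : IsSemiRegular A) (n : ℕ) {x : Y}
    (hx : x ∈ kerPow A n) : ∃ y, A y = x := by
  induction n generalizing x with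
  | zero => exact ⟨0, by simpa [mem_kerPow, eq_comm] using hx⟩
  | succ n ih =>
    rw [mem_kerPow, pow_succ_apply'] at hx
    obtain ⟨y, hy⟩ := hA.ker_le_rangePow (n + 1) hx
    obtain ⟨w, hw⟩ := ih (x := x - A y) (by
      rw [mem_kerPow, map_sub, ← pow_succ_apply]
      exact sub_eq_zero.2 hy.symm)
    exact ⟨w + y, by rw [map_add, hw, sub_add_cancel]⟩

theorem zero_mem_ascent_set_iff :
    0 ∈ {n : ℕ | kerPow A n = kerPow A (n + 1)} ↔ alpha A = 0 := by
  have h0 : kerPow A 0 = ⊥ := by ext x; simp [mem_kerPow]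
  have h1 : kerPow A (0 + 1) = LinearMap.ker (A : Y →ₗ[ℂ] Y) := by ext x; simp [mem_kerPow]
  rw [Set.mem_ofPred_eq, alpha, Cardinal.toENat_eq_zero, rank_zero_iff,
    Submodule.subsingleton_iff_eq_bot, h0, h1, eq_comm]

theorem zero_mem_descent_set_iff :
    0 ∈ {n : ℕ | rangePow A n = rangePow A (n + 1)} ↔ beta A = 0 := by
  have h0 : rangePow A 0 = ⊤ := by ext x; simp [mem_rangePow]
  have h1 : rangePow A (0 + 1) = LinearMap.range (A : Y →ₗ[ℂ] Y) := by
    ext x; simp [mem_rangePow]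
  rw [Set.mem_ofPred_eq, beta, Cardinal.toENat_eq_zero, rank_zero_iff,
    Submodule.Quotient.subsingleton_iff, h0, h1, eq_comm]

theorem IsSemiRegular.zero_mem_of_mem_ascent_set (hA : IsSemiRegular A) {n : ℕ}
    (hn : n ∈ {n : ℕ | kerPow A n = kerPow A (n + 1)}) :
    0 ∈ {n : ℕ | kerPow A n = kerPow A (n + 1)} := by
  refine le_antisymm (fun x hx => ?_) fun x hx => ?_
  · have : x = 0 := by simpa [mem_kerPow] using hx
    simp [this]
  · have hAx : A x = 0 := by simpa [mem_kerPow] using hx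
    obtain ⟨y, rfl⟩ := mem_rangePow.1 (hA.ker_le_rangePow n hAx)
    have hy : y ∈ kerPow A (n + 1) := by rwa [mem_kerPow, pow_succ_apply']
    rw [← show kerPow A n = kerPow A (n + 1) from hn, mem_kerPow] at hy
    rw [hy]
    exact zero_mem _

theorem IsSemiRegular.zero_mem_of_mem_descent_set (hA : IsSemiRegular A) {n : ℕ}
    (hn : n ∈ {n : ℕ | rangePow A n = rangePow A (n + 1)}) :
    0 ∈ {n : ℕ | rangePow A n = rangePow A (n + 1)} := by
  refine le_antisymm (fun x _ => ?_) fun x _ => ⟨x, by simp⟩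
  have hx : (A ^ n) x ∈ rangePow A n := ⟨x, rfl⟩
  rw [show rangePow A n = rangePow A (n + 1) from hn] at hx
  obtain ⟨y, hy⟩ := mem_rangePow.1 hx
  obtain ⟨w, hw⟩ := hA.kerPow_le_range n (x := x - A y) (by
    rw [mem_kerPow, map_sub, ← pow_succ_apply, hy, sub_self])
  exact ⟨w + y, by simp [hw]⟩

variable {Z : Type*} [NormedAddCommGroup Z] [NormedSpace ℂ Z] {B : Z →L[ℂ] Z}

theorem IsSemiRegular.ascent_eq (hA : IsSemiRegular A) (hB : IsSemiRegular B)
    (h : alpha A = alpha B) : ascent A = ascent B :=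
  natInf_eq_of_mem_imp_zero_mem (fun _ => hA.zero_mem_of_mem_ascent_set)
    (fun _ => hB.zero_mem_of_mem_ascent_set)
    (by rw [zero_mem_ascent_set_iff, zero_mem_ascent_set_iff, h])

theorem IsSemiRegular.descent_eq (hA : IsSemiRegular A) (hB : IsSemiRegular B)
    (h : beta A = beta B) : descent A = descent B :=
  natInf_eq_of_mem_imp_zero_mem (fun _ => hA.zero_mem_of_mem_descent_set)
    (fun _ => hB.zero_mem_of_mem_descent_set)
    (by rw [zero_mem_descent_set_iff, zero_mem_descent_set_iff, h])

/-- The hyperrange `⋂ n, R(A ^ n)`. -/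
def hyperrange (A : Y →L[ℂ] Y) : Submodule ℂ Y := ⨅ n, rangePow A n

theorem mem_hyperrange {x : Y} : x ∈ hyperrange A ↔ ∀ n, x ∈ rangePow A n := by
  simp [hyperrange]

theorem map_mem_hyperrange : ∀ x ∈ hyperrange A, A x ∈ hyperrange A := by
  intro x hx
  rw [mem_hyperrange] at hx ⊢
  intro n
  obtain ⟨y, rfl⟩ := mem_rangePow.1 (hx n)
  exact mem_rangePow.2 ⟨A y, by rw [← pow_succ_apply, pow_succ_apply']⟩

theorem sub_smul_one_mem_hyperrange (z : ℂ) :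
    ∀ x ∈ hyperrange A, (A - z • 1) x ∈ hyperrange A := fun x hx =>
  (hyperrange A).sub_mem (map_mem_hyperrange x hx) ((hyperrange A).smul_mem z hx)

theorem ker_sub_smul_one_le_hyperrange {z : ℂ} (hz : z ≠ 0) :
    LinearMap.ker ((A - z • 1 : Y →L[ℂ] Y) : Y →ₗ[ℂ] Y) ≤ hyperrange A := by
  intro x hx
  have hx' : A x = z • x := by simpa [sub_eq_zero] using hx
  have hpow : ∀ n : ℕ, (A ^ n) x = z ^ n • x := by
    intro n
    induction n with
    | zero => simp
    | succ n ih => rw [pow_succ_apply, hx', map_smul, ih, smul_smul, pow_succ']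
  rw [mem_hyperrange]
  intro n
  exact mem_rangePow.2 ⟨(z ^ n)⁻¹ • x, by
    rw [map_smul, hpow, inv_smul_smul₀ (pow_ne_zero n hz)]⟩

/-- Any preimage works: if also `y = A^(n+1) w`, it differs from `A^n w` by an element of `ker A`,
which lies in `R(A^n)`. -/
theorem IsSemiRegular.exists_mem_hyperrange (hA : IsSemiRegular A) {y : Y}
    (hy : y ∈ hyperrange A) : ∃ x ∈ hyperrange A, A x = y := by
  rw [mem_hyperrange] at hy
  obtain ⟨x, hx⟩ := hy 1
  have hx' : A x = y := by simpa using hx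
  refine ⟨x, mem_hyperrange.2 fun n => ?_, hx'⟩
  obtain ⟨w, hw⟩ := hy (n + 1)
  have h := hA.ker_le_rangePow n (x := x - (A ^ n) w) (by
    rw [map_sub, hx', sub_eq_zero, ← pow_succ_apply']; exact hw.symm)
  simpa only [sub_add_cancel] using (rangePow A n).add_mem h (mem_rangePow.2 ⟨w, rfl⟩)

theorem IsSemiRegular.surjective_restrict_hyperrange (hA : IsSemiRegular A) :
    Function.Surjective (A.restrict (map_mem_hyperrange (A := A))) := by
  rintro ⟨y, hy⟩
  obtain ⟨x, hx, rfl⟩ := hA.exists_mem_hyperrange hy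
  exact ⟨⟨x, hx⟩, rfl⟩

theorem alpha_sub_smul_one_eq_restrict_hyperrange {z : ℂ} (hz : z ≠ 0) :
    alpha (A.restrict (map_mem_hyperrange (A := A)) - z • 1) = alpha (A - z • 1) :=
  congrArg Cardinal.toENat (rank_ker_restrict (sub_smul_one_mem_hyperrange z)
    (ker_sub_smul_one_le_hyperrange hz))

theorem IsSemiRegular.alpha_restrict_hyperrange (hA : IsSemiRegular A) :
    alpha (A.restrict (map_mem_hyperrange (A := A))) = alpha A :=
  congrArg Cardinal.toENat (rank_ker_restrict map_mem_hyperrange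
    fun _ hx => mem_hyperrange.2 fun n => hA.ker_le_rangePow n hx)

variable [CompleteSpace Y]

/-- Since `ker A ≤ R(A^n)`, the preimage of `R(A^(n+1))` under `A` is `R(A^n)`, and `A` is a
quotient map onto its closed range. -/
theorem IsSemiRegular.isClosed_rangePow (hA : IsSemiRegular A) (n : ℕ) :
    IsClosed (rangePow A n : Set Y) := by
  induction n with
  | zero =>
    have : rangePow A 0 = ⊤ := eq_top_iff.2 fun x _ => ⟨x, by simp⟩
    simp [this]
  | succ n ih =>
    have hcl : IsClosed ((LinearMap.range (A : Y →ₗ[ℂ] Y) : Submodule ℂ Y) : Set Y) := hA.1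
    have := hcl.completeSpace_coe
    have hsurj : Function.Surjective A.rangeRestrict := by
      rintro ⟨_, x, rfl⟩
      exact ⟨x, rfl⟩
    have hpre : A.rangeRestrict ⁻¹' (Subtype.val ⁻¹' (rangePow A (n + 1) : Set Y)) =
        rangePow A n := by
      ext x
      constructor
      · rintro ⟨w, hw⟩
        have hw' : A ((A ^ n) w) = A x := (pow_succ_apply' n w).symm.trans hw
        have h := hA.ker_le_rangePow n (x := x - (A ^ n) w) (by rw [map_sub, hw', sub_self])
        simpa only [sub_add_cancel, SetLike.mem_coe] using
          (rangePow A n).add_mem h (mem_rangePow.2 ⟨w, rfl⟩)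
      · rintro ⟨w, rfl⟩
        exact ⟨w, pow_succ_apply' n w⟩
    have h1 := ((A.rangeRestrict.isQuotientMap hsurj).isClosed_preimage).1 (hpre ▸ ih)
    have h2 := hcl.isClosedEmbedding_subtypeVal.isClosedMap _ h1
    convert h2
    ext x
    constructor
    · rintro ⟨w, rfl⟩
      exact ⟨⟨_, (A ^ n) w, (pow_succ_apply' n w).symm⟩, ⟨w, rfl⟩, rfl⟩
    · rintro ⟨y, hy, rfl⟩
      exact hy

theorem IsSemiRegular.isClosed_hyperrange (hA : IsSemiRegular A) :
    IsClosed (hyperrange A : Set Y) := by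
  rw [hyperrange, Submodule.coe_iInf]
  exact isClosed_iInter hA.isClosed_rangePow

/-- The limit is punctured because eigenvectors lie in the hyperrange for `z ≠ 0` by dividing by
`z^n`, while at `z = 0` semi-regularity is what puts the kernel there. -/
theorem IsSemiRegular.tendsto_alpha (hA : IsSemiRegular A) :
    Tendsto (fun z : ℂ => alpha (A - z • 1)) (𝓝[≠] 0) (𝓝 (alpha A)) := by
  have := hA.isClosed_hyperrange.completeSpace_coe
  rw [← hA.alpha_restrict_hyperrange]
  refine ((tendsto_alpha_of_surjective hA.surjective_restrict_hyperrange).mono_left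
    nhdsWithin_le_nhds).congr' ?_
  filter_upwards [self_mem_nhdsWithin] with z hz
  exact alpha_sub_smul_one_eq_restrict_hyperrange hz

theorem IsSemiRegular.eventually_hyperrange_le_range (hA : IsSemiRegular A) :
    ∀ᶠ z : ℂ in 𝓝 0,
      hyperrange A ≤ LinearMap.range ((A - z • 1 : Y →L[ℂ] Y) : Y →ₗ[ℂ] Y) := by
  have := hA.isClosed_hyperrange.completeSpace_coe
  filter_upwards [(tendsto_sub_smul_one (A.restrict map_mem_hyperrange)).eventually
    (eventually_surjective hA.surjective_restrict_hyperrange)] with z hz y hy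
  obtain ⟨x, hx⟩ := hz ⟨y, hy⟩
  exact ⟨x, congrArg Subtype.val hx⟩

theorem IsSemiRegular.tendsto_beta (hA : IsSemiRegular A) :
    Tendsto (fun z : ℂ => beta (A - z • 1)) (𝓝 0) (𝓝 (beta A)) := by
  have hcl := hA.isClosed_hyperrange
  set R := hyperrange A
  -- Passing to the quotient keeps `β(A - z)` as long as `R ≤ R(A - z)`, which holds for small `z`.
  let V : (Y ⧸ R) →L[ℂ] (Y ⧸ R) :=
    R.liftQL (R.mkQL ∘L A) fun x hx => by simpa using map_mem_hyperrange x hx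
  have hVmk : ∀ x, V (R.mkQ x) = R.mkQ (A x) := fun _ => rfl
  have hinj : Function.Injective V := by
    rw [injective_iff_map_eq_zero]
    intro y hy
    obtain ⟨x, rfl⟩ := R.mkQ_surjective y
    rw [hVmk] at hy
    have hx : A x ∈ R := by simpa using hy
    obtain ⟨w, hw, hwx⟩ := hA.exists_mem_hyperrange hx
    have h : x - w ∈ R := mem_hyperrange.2 fun n => hA.ker_le_rangePow n (by
      rw [map_sub, hwx, sub_self])
    have : x ∈ R := by simpa using R.add_mem h hw
    simpa using this
  have hle : R ≤ LinearMap.range (A : Y →ₗ[ℂ] Y) := fun y hy => by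
    obtain ⟨x, -, hx⟩ := hA.exists_mem_hyperrange hy
    exact ⟨x, hx⟩
  have hVcl : IsClosed (Set.range V) := by
    have hq : IsQuotientMap (R.mkQL : Y → Y ⧸ R) := R.isOpenQuotientMap_mkQ.isQuotientMap
    rw [← hq.isClosed_preimage]
    convert hA.1
    ext x
    constructor
    · rintro ⟨y, hy⟩
      obtain ⟨w, rfl⟩ := R.mkQ_surjective y
      rw [hVmk] at hy
      have hmem : A w - x ∈ R := (Submodule.Quotient.eq R).1 hy
      obtain ⟨u, hu⟩ := hle hmem
      exact ⟨w - u, by rw [map_sub]; erw [hu]; abel⟩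
    · rintro ⟨w, rfl⟩
      exact ⟨R.mkQ w, rfl⟩
  have hbeta : ∀ z : ℂ, R ≤ LinearMap.range ((A - z • 1 : Y →L[ℂ] Y) : Y →ₗ[ℂ] Y) →
      beta (V - z • 1) = beta (A - z • 1) := by
    intro z hz
    have hV : ((V - z • 1 : (Y ⧸ R) →L[ℂ] (Y ⧸ R)) : (Y ⧸ R) →ₗ[ℂ] (Y ⧸ R)) =
        R.mapQ R ((A - z • 1 : Y →L[ℂ] Y) : Y →ₗ[ℂ] Y) (sub_smul_one_mem_hyperrange z) := by
      apply Submodule.linearMap_qext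
      ext x
      rfl
    rw [beta, hV, rank_quotient_range_mapQ _ hz, beta]
  have h0 : beta V = beta A := by
    have h := hbeta 0 (by simpa using hle)
    have hV0 : V - (0 : ℂ) • 1 = V := ContinuousLinearMap.ext fun x => by
      change V x - (0 : ℂ) • x = V x
      rw [zero_smul, sub_zero]
    rwa [hV0, zero_smul, sub_zero] at h
  rw [← h0]
  refine (tendsto_beta_of_injective hinj hVcl).congr' ?_
  filter_upwards [hA.eventually_hyperrange_le_range] with z hz
  exact hbeta z hz

end SemiRegular

/-! ### Comparison of two decompositions. -/

section Decomposition

variable {X : Type*} [NormedAddCommGroup X] [NormedSpace ℂ X] {T : X →L[ℂ] X}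
  {M N : Submodule ℂ X}

theorem IsRed.alpha_beta_sub_smul_one (h : IsRed T M N) {z : ℂ}
    (hz : z ∉ spectrum ℂ (restr T N h.inv_right)) :
    alpha (restr T M h.inv_left - z • 1) = alpha (T - z • 1) ∧
      beta (restr T M h.inv_left - z • 1) = beta (T - z • 1) := by
  have hM : ∀ x ∈ M, (T - z • 1) x ∈ M := fun x hx =>
    M.sub_mem (h.inv_left x hx) (M.smul_mem z hx)
  have hN : ∀ x ∈ N, (T - z • 1) x ∈ N := fun x hx =>
    N.sub_mem (h.inv_right x hx) (N.smul_mem z hx)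
  have hu : IsUnit (restr T N h.inv_right - z • 1) := by
    have := (spectrum.notMem_iff.1 hz).neg
    rwa [neg_sub, Algebra.algebraMap_eq_smul_one] at this
  obtain ⟨u, hu⟩ := hu
  have hbij : Function.Bijective
      (((T - z • 1 : X →L[ℂ] X) : X →ₗ[ℂ] X).restrict hN) := by
    have hb : Function.Bijective (restr T N h.inv_right - z • 1 : N →L[ℂ] N) := by
      rw [← hu]
      exact (ContinuousLinearEquiv.unitsEquiv ℂ N u).bijective
    exact hb
  exact ⟨congrArg Cardinal.toENat (rank_ker_restrict hM
    (ker_le_of_isCompl_of_injective_restrict hM hN h.isCompl hbij.1)),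
    congrArg Cardinal.toENat (rank_quotient_range_restrict hM hN h.isCompl hbij.2)⟩

/-- Only "frequently" is available, as both sets may accumulate at `0`. Near any `w ≠ 0`, however,
both are avoided on a punctured neighbourhood, and such `w` exist arbitrarily close to `0`. -/
theorem frequently_notMem_of_accPt_subset {s t : Set ℂ}
    (hs : {z : ℂ | AccPt z (𝓟 s)} ⊆ {0}) (ht : {z : ℂ | AccPt z (𝓟 t)} ⊆ {0}) :
    ∃ᶠ z in 𝓝[≠] (0 : ℂ), z ∉ s ∧ z ∉ t := by
  have key : ∀ {s : Set ℂ}, {z : ℂ | AccPt z (𝓟 s)} ⊆ {0} → ∀ w : ℂ, w ≠ 0 →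
      ∀ᶠ z in 𝓝[≠] w, z ∉ s := by
    intro s hs w hw
    have : ¬ AccPt w (𝓟 s) := fun h => hw (hs h)
    rw [accPt_iff_frequently_nhdsNE] at this
    simpa using this
  rw [frequently_iff]
  intro U hU
  obtain ⟨O, hO, h0, hOU⟩ := mem_nhdsWithin.1 hU
  obtain ⟨w, hw0, hwO⟩ :=
    nonempty_of_mem (inter_mem_nhdsWithin {(0 : ℂ)}ᶜ (hO.mem_nhds h0))
  have hV : O ∩ {0}ᶜ ∈ 𝓝[≠] w :=
    mem_nhdsWithin_of_mem_nhds ((hO.inter isOpen_compl_singleton).mem_nhds ⟨hwO, hw0⟩)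
  obtain ⟨z, hz, hzO⟩ := (((key hs w hw0).and (key ht w hw0)).and hV).exists
  exact ⟨z, hOU hzO, hz⟩

variable [CompleteSpace X] {M₁ N₁ M₂ N₂ : Submodule ℂ X}

theorem IsGzKD.alpha_beta_eq (h₁ : IsGzKD T M₁ N₁) (h₂ : IsGzKD T M₂ N₂) :
    alpha (restr T M₁ h₁.inv_left) = alpha (restr T M₂ h₂.inv_left) ∧
      beta (restr T M₁ h₁.inv_left) = beta (restr T M₂ h₂.inv_left) := by
  have := h₁.closed_left.completeSpace_coe
  have := h₂.closed_left.completeSpace_coe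
  have hfreq : ∃ᶠ z in 𝓝[≠] (0 : ℂ),
      (alpha (restr T M₁ h₁.inv_left - z • 1) = alpha (restr T M₂ h₂.inv_left - z • 1) ∧
        beta (restr T M₁ h₁.inv_left - z • 1) = beta (restr T M₂ h₂.inv_left - z • 1)) := by
    refine (frequently_notMem_of_accPt_subset h₁.zeroloid h₂.zeroloid).mono fun z hz => ?_
    obtain ⟨ha₁, hb₁⟩ := h₁.toIsRed.alpha_beta_sub_smul_one hz.1
    obtain ⟨ha₂, hb₂⟩ := h₂.toIsRed.alpha_beta_sub_smul_one hz.2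
    exact ⟨ha₁.trans ha₂.symm, hb₁.trans hb₂.symm⟩
  exact ⟨tendsto_nhds_unique_of_frequently_eq h₁.semiRegular.tendsto_alpha
      h₂.semiRegular.tendsto_alpha (hfreq.mono fun _ h => h.1),
    tendsto_nhds_unique_of_frequently_eq
      (h₁.semiRegular.tendsto_beta.mono_left nhdsWithin_le_nhds)
      (h₂.semiRegular.tendsto_beta.mono_left nhdsWithin_le_nhds) (hfreq.mono fun _ h => h.2)⟩

theorem IsGzKD.invariants_eq (h₁ : IsGzKD T M₁ N₁) (h₂ : IsGzKD T M₂ N₂) :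
    alpha (restr T M₁ h₁.inv_left) = alpha (restr T M₂ h₂.inv_left) ∧
      beta (restr T M₁ h₁.inv_left) = beta (restr T M₂ h₂.inv_left) ∧
      ascent (restr T M₁ h₁.inv_left) = ascent (restr T M₂ h₂.inv_left) ∧
      descent (restr T M₁ h₁.inv_left) = descent (restr T M₂ h₂.inv_left) := by
  obtain ⟨ha, hb⟩ := h₁.alpha_beta_eq h₂
  exact ⟨ha, hb, h₁.semiRegular.ascent_eq h₂.semiRegular ha,
    h₁.semiRegular.descent_eq h₂.semiRegular hb⟩

end Decomposition

end GzKato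

theorem proposition2p8 {X : Type*} [NormedAddCommGroup X] [NormedSpace ℂ X] [CompleteSpace X]
    (T : X →L[ℂ] X) (hT : GzKato.IsGzKato T) :
    (∀ (M₁ N₁ M₂ N₂ : Submodule ℂ X)
        (h₁ : GzKato.IsGzKD T M₁ N₁) (h₂ : GzKato.IsGzKD T M₂ N₂),
      GzKato.alpha (GzKato.restr T M₁ h₁.inv_left) =
          GzKato.alpha (GzKato.restr T M₂ h₂.inv_left) ∧
      GzKato.beta (GzKato.restr T M₁ h₁.inv_left) =
          GzKato.beta (GzKato.restr T M₂ h₂.inv_left) ∧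
      GzKato.ascent (GzKato.restr T M₁ h₁.inv_left) =
          GzKato.ascent (GzKato.restr T M₂ h₂.inv_left) ∧
      GzKato.descent (GzKato.restr T M₁ h₁.inv_left) =
          GzKato.descent (GzKato.restr T M₂ h₂.inv_left)) ∧
    (∀ (M N : Submodule ℂ X) (h : GzKato.IsGzKD T M N),
      GzKato.alphaTilde T hT = GzKato.alpha (GzKato.restr T M h.inv_left) ∧
      GzKato.betaTilde T hT = GzKato.beta (GzKato.restr T M h.inv_left) ∧
      GzKato.ascentTilde T hT = GzKato.ascent (GzKato.restr T M h.inv_left) ∧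
      GzKato.descentTilde T hT = GzKato.descent (GzKato.restr T M h.inv_left)) := by
  exact ⟨fun _ _ _ _ h₁ h₂ => h₁.invariants_eq h₂,
    fun _ _ h => hT.choose_spec.choose_spec.invariants_eq h⟩
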